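/- Let $p_1,p_2,p_3,p_4\in\mathbb R$ and consider the equation $$\ddot x-x+x^3=\varepsilon\,[(p_1+p_2x-x^2)\dot x+p_3\sin p_4t].$$ For $\varepsilon=0$, with $y=\dot x$, it has the first integral $H(x,y)=\frac{y^2}{2}-\frac{x^2}{2}+\frac{x^4}{4}$; its closed phase curves fill the two cells $G_1^{\pm}=\{-\frac14<H<0,\ \pm x>0\}$ inside the figure-eight $\{H=0\}$ and the cell $G_2=\{H>0\}$ outside it. On the closed curve $H=h$ of a cell let $I=I(h)=\frac1{2\pi}\oint y\,dx$ be the action, $\omega(I)=dh/dI$ the frequency, $\theta$ (mod $2\pi$) the conjugate angle variable ($\dot\theta=\omega$ along the unperturbed motion) and $x=x(I,\theta)$, $y=y(I,\theta)$ the corresponding parametrization of the curve. Put $$F_1(I,\theta,\varphi)=[(p_1+p_2x-x^2)y+p_3\sin\varphi]\,\frac{\partial x}{\partial\theta}(I,\theta),\qquad B(h)=\frac1{2\pi}\oint (p_1+p_2x-x^2)\,y\,dx .$$ A closed curve (level) $I=I_{pq}$ of one of the cells is a resonance level if $\omega(I_{pq})=\frac qp\,p_4$ for some coprime integers $p\neq0$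 and $q$; it is splittable if, for such $p,q$, the equation $A_0(v,I_{pq})=0$ has a simple root $v$, where $$A_0(v,I_{pq})=\frac1{2\pi p}\int_0^{2\pi p}F_1\Bigl(I_{pq},\,v+\frac{q\varphi}{p},\,\varphi\Bigr)d\varphi .$$ Let $V$ be obtained from $G_1^+\cup G_1^-\cup G_2$ by removing an arbitrary open neighbourhood of the figure-eight $\{H=0\}$ and an arbitrary open set containing all the closed curves $H=h$ of the three cells on which the function $B$ of the cell vanishes. Then only finitely many splittable resonance levels are contained in $V$. -/

import Mathlib

open Set

/-- The perturbation `(p₁ + p₂ x - x²) y + p₃ sin φ` (the coefficient of `ε`), where `y = ẋ` and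
`φ = p₄ t` is the phase of the periodic forcing. -/
noncomputable def perturbation (p₁ p₂ p₃ x y φ : ℝ) : ℝ :=
  (p₁ + p₂ * x - x ^ 2) * y + p₃ * Real.sin φ

/-- The first integral `H(x, y) = y²/2 - x²/2 + x⁴/4` of the unperturbed equation
`ẋ = y, ẏ = x - x³`. -/
noncomputable def energy (z : ℝ × ℝ) : ℝ :=
  z.2 ^ 2 / 2 - z.1 ^ 2 / 2 + z.1 ^ 4 / 4

/-- The unperturbed figure-eight: the saddle `(0, 0)` with its two separatrix loops. -/
def figureEight : Set (ℝ × ℝ) := {z | energy z = 0}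

/-- The three cells filled with closed phase curves of the unperturbed equation:
`right` and `left` are inside the two loops of the figure-eight, `outer` is outside it. -/
inductive Cell : Type
  | right : Cell
  | left : Cell
  | outer : Cell

namespace Cell

/-- The side of the `y`-axis on which the cell lies (no restriction for the outer cell). -/
def xRange : Cell → Set ℝ
  | right => Ioi 0
  | left => Iio 0
  | outer => univ

/-- The energy values `h` of the closed phase curves filling the cell. -/
noncomputable def energies : Cell → Set ℝ
  | right => Ioo (-(1 / 4)) 0
  | left => Ioo (-(1 / 4)) 0
  | outer => Ioi 0

/-- The cell, as a region of the phase plane. -/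
def domain (c : Cell) : Set (ℝ × ℝ) :=
  {z | energy z ∈ c.energies ∧ z.1 ∈ c.xRange}

/-- The phase curve `H(x, y) = h` in the cell. -/
def curve (c : Cell) (h : ℝ) : Set (ℝ × ℝ) :=
  {z | energy z = h ∧ z.1 ∈ c.xRange}

/-- The ordinate `y ≥ 0` on the upper half of the curve `H(x, y) = h` over `x`. It is `0` when
there is no point of the curve over `x`. -/
noncomputable def upperBranch (h x : ℝ) : ℝ :=
  Real.sqrt (2 * h + x ^ 2 - x ^ 4 / 2)

/-- The action `I(h) = (1 / 2π) ∮ y dx` of the curve `H = h` of the cell. Since the curve is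
symmetric in `y`, the contour integral is twice the integral over the upper half; the
integrand vanishes beyond the turning points. -/
noncomputable def action (c : Cell) (h : ℝ) : ℝ :=
  (1 / Real.pi) * ∫ x in c.xRange, upperBranch h x

/-- The frequency `ω = dh / dI` of the unperturbed oscillations on the curve `H = h`. -/
noncomputable def frequency (c : Cell) (h : ℝ) : ℝ :=
  (deriv c.action h)⁻¹

/-- The Poincaré–Pontryagin generating function `B(h) = (1 / 2π) ∮ (p₁ + p₂ x - x²) y dx`
of the cell. -/
noncomputable def generatingFunction (p₁ p₂ : ℝ) (c : Cell) (h : ℝ) : ℝ :=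
  (1 / Real.pi) * ∫ x in c.xRange, (p₁ + p₂ * x - x ^ 2) * upperBranch h x

/-- `θ ↦ (x(θ), y(θ))` parametrizes the closed curve `H = h` of the cell by the angle
variable `θ`, conjugate to the action: `θ` runs over the curve once as it
increases by `2π`, and `θ̇ = ω` along the unperturbed motion `ẋ = y, ẏ = x - x³`. The origin
of `θ` may be any point of the curve. -/
structure IsAngleParametrization (c : Cell) (h : ℝ) (x y : ℝ → ℝ) : Prop where
  hasDerivAt_x : ∀ θ, HasDerivAt x (y θ / c.frequency h) θ
  hasDerivAt_y : ∀ θ, HasDerivAt y ((x θ - x θ ^ 3) / c.frequency h) θ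
  periodic_x : Function.Periodic x (2 * Real.pi)
  periodic_y : Function.Periodic y (2 * Real.pi)
  bijOn : BijOn (fun θ => (x θ, y θ)) (Ico 0 (2 * Real.pi)) (c.curve h)

end Cell

/-- The averaged function
`A₀(v) = (1 / 2πp) ∫₀^{2πp} F₁(v + qφ/p, φ) dφ`, where
`F₁(θ, φ) = [(p₁ + p₂ x - x²) y + p₃ sin φ] x'_θ` is the right-hand side of the equation
`İ = ε F₁` and `x = x(θ)`, `y = y(θ)` is the level under consideration, parametrized by the
angle variable. -/
noncomputable def averagedFunction (p₁ p₂ p₃ : ℝ) (p q : ℤ) (x y : ℝ → ℝ) (v : ℝ) : ℝ :=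
  (1 / (2 * Real.pi * (p : ℝ))) * ∫ φ in (0 : ℝ)..(2 * Real.pi * (p : ℝ)),
    perturbation p₁ p₂ p₃ (x (v + (q : ℝ) * φ / (p : ℝ))) (y (v + (q : ℝ) * φ / (p : ℝ))) φ *
      deriv x (v + (q : ℝ) * φ / (p : ℝ))

/-- The closed phase curve `γ` is a splittable resonance level: `γ` is the curve `H = h` of one
of the cells, `ω = (q / p) p₄` on it for some coprime integers `p, q`, and the equation
`A₀(v) = 0` has a simple root. -/
def IsSplittableResonanceLevel (p₁ p₂ p₃ p₄ : ℝ) (γ : Set (ℝ × ℝ)) : Prop :=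
  ∃ c : Cell, ∃ h ∈ c.energies, γ = c.curve h ∧
    ∃ p q : ℤ, p ≠ 0 ∧ IsCoprime p q ∧ c.frequency h = (q : ℝ) / (p : ℝ) * p₄ ∧
      ∃ x y : ℝ → ℝ, c.IsAngleParametrization h x y ∧
        ∃ v : ℝ, averagedFunction p₁ p₂ p₃ p q x y v = 0 ∧
          deriv (averagedFunction p₁ p₂ p₃ p q x y) v ≠ 0

/-- What remains of the three cells when the sets `N` and `W` are removed. -/
def remainingRegion (N W : Set (ℝ × ℝ)) : Set (ℝ × ℝ) :=
  (⋃ c : Cell, c.domain) \ (N ∪ W)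

/-! The autonomous part of `A₀` is independent of `v`, and the forcing, a pure first harmonic,
contributes nothing unless `q ∣ p` (`deriv_averagedFunction_eq_zero`). A simple root therefore needs
`q ∣ p`, hence `q = ±1` by coprimality, and the period of the level is an integer multiple of `2π /
|p₄|`.

It remains to count such levels. In each cell the period is strictly monotone in `h`
(`period_outer_strictAntiOn`, `period_right_strictMonoOn`), so each multiple is attained on at most
one curve. Away from the saddle the period is bounded (`exists_period_le`), so only finitely many
multiples occur.

The frequency is never computed from the action integral. An angle parametrization closes up exactly
once in `2π`, which forces `|ω|` times the period to be `2π` (`two_pi_eq`); the period is an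
explicit integral in a coordinate that turns the level into the unit circle. -/

/-! ### Averaging over the resonant phase. -/

/-- The averaged autonomous part does not depend on the phase. -/
theorem integral_comp_add_mul_eq_of_periodic {P : ℝ → ℝ}
    (hP : Function.Periodic P (2 * Real.pi)) {p q : ℤ} (hp : p ≠ 0) (hq : q ≠ 0) (v w : ℝ) :
    ∫ φ in (0 : ℝ)..(2 * Real.pi * (p : ℝ)), P (v + (q : ℝ) * φ / (p : ℝ)) =
      ∫ φ in (0 : ℝ)..(2 * Real.pi * (p : ℝ)), P (w + (q : ℝ) * φ / (p : ℝ)) := by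
  have hp' : (p : ℝ) ≠ 0 := by exact_mod_cast hp
  have hq' : (q : ℝ) ≠ 0 := by exact_mod_cast hq
  have key : ∀ v : ℝ, ∫ φ in (0 : ℝ)..(2 * Real.pi * (p : ℝ)), P (v + (q : ℝ) * φ / (p : ℝ)) =
      ((q : ℝ) / p)⁻¹ • ∫ φ in v..(v + q * (2 * Real.pi)), P φ := by
    intro v
    have := intervalIntegral.integral_comp_add_mul (a := 0) (b := 2 * Real.pi * (p : ℝ)) P
      (div_ne_zero hq' hp') v
    rw [show v + (q : ℝ) / p * (2 * Real.pi * p) = v + q * (2 * Real.pi) by field_simp,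
      mul_zero, add_zero] at this
    rw [← this]
    congr 1
    ext φ
    rw [mul_div_right_comm]
  rw [key, key, (hP.int_mul q).intervalIntegral_add_eq v w]

/-- A forcing of frequency one averages to zero against `Q(v + q φ / p)` when `q ∤ p`. -/
theorem integral_sin_mul_comp_eq_zero {Q : ℝ → ℝ} (hc : Continuous Q)
    (hQ : Function.Periodic Q (2 * Real.pi)) {p q : ℤ} (hp : p ≠ 0) (hq : q ≠ 0)
    (hqp : ¬ q ∣ p) (v : ℝ) :
    ∫ φ in (0 : ℝ)..(2 * Real.pi * (p : ℝ)),
      Real.sin φ * Q (v + (q : ℝ) * φ / (p : ℝ)) = 0 := by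
  have hp' : (p : ℝ) ≠ 0 := by exact_mod_cast hp
  have hq' : (q : ℝ) ≠ 0 := by exact_mod_cast hq
  -- Shifting `φ` by `α` moves the argument of `Q` by exactly `2π`.
  set α : ℝ := 2 * Real.pi * p / q with hα
  have shift : ∀ s : ℝ → ℝ, Function.Periodic s (2 * Real.pi) →
      ∫ φ in (0 : ℝ)..(2 * Real.pi * (p : ℝ)), s φ * Q (v + (q : ℝ) * φ / (p : ℝ)) =
      ∫ φ in (0 : ℝ)..(2 * Real.pi * (p : ℝ)),
        s (φ + α) * Q (v + (q : ℝ) * φ / (p : ℝ)) := by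
    intro s hs
    have hper : Function.Periodic (fun φ => s φ * Q (v + (q : ℝ) * φ / (p : ℝ)))
        (2 * Real.pi * p) := by
      intro φ
      have h1 := hs.int_mul p φ
      have h2 := hQ.int_mul q (v + (q : ℝ) * φ / (p : ℝ))
      simp only
      rw [show φ + 2 * Real.pi * p = φ + p * (2 * Real.pi) by ring, h1, ← h2]
      congr 2
      field_simp
      ring
    have h3 := hper.intervalIntegral_add_eq 0 α
    rw [zero_add] at h3
    rw [h3]
    have h4 := intervalIntegral.integral_comp_add_right (a := 0) (b := 2 * Real.pi * (p : ℝ))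
      (fun φ => s φ * Q (v + (q : ℝ) * φ / (p : ℝ))) α
    rw [zero_add, add_comm _ α] at h4
    rw [← h4]
    congr 1
    ext φ
    congr 1
    rw [← hQ (v + (q : ℝ) * φ / (p : ℝ))]
    congr 1
    rw [hα]
    field_simp
    ring
  have hcQ : Continuous fun φ : ℝ => Q (v + (q : ℝ) * φ / (p : ℝ)) := by fun_prop
  have hi1 : IntervalIntegrable (fun φ => Real.sin φ * Q (v + (q : ℝ) * φ / (p : ℝ)))
      MeasureTheory.volume 0 (2 * Real.pi * p) :=
    (Real.continuous_sin.mul hcQ).intervalIntegrable _ _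
  have hi2 : IntervalIntegrable (fun φ => Real.cos φ * Q (v + (q : ℝ) * φ / (p : ℝ)))
      MeasureTheory.volume 0 (2 * Real.pi * p) :=
    (Real.continuous_cos.mul hcQ).intervalIntegrable _ _
  have e1 := shift _ Real.sin_periodic
  have e2 := shift _ Real.cos_periodic
  set K := ∫ φ in (0 : ℝ)..(2 * Real.pi * (p : ℝ)),
    Real.sin φ * Q (v + (q : ℝ) * φ / (p : ℝ))
  set L := ∫ φ in (0 : ℝ)..(2 * Real.pi * (p : ℝ)),
    Real.cos φ * Q (v + (q : ℝ) * φ / (p : ℝ))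
  -- The vector `(K, L)` is fixed by a rotation through `α`, which is not the identity when `q ∤ p`;
  -- hence it is zero.
  have f1 : K = Real.cos α * K + Real.sin α * L := by
    refine e1.trans ?_
    rw [← intervalIntegral.integral_const_mul, ← intervalIntegral.integral_const_mul,
      ← intervalIntegral.integral_add (hi1.const_mul _) (hi2.const_mul _)]
    congr 1
    ext φ
    rw [Real.sin_add]
    ring
  have f2 : L = Real.cos α * L - Real.sin α * K := by
    refine e2.trans ?_
    rw [← intervalIntegral.integral_const_mul, ← intervalIntegral.integral_const_mul,
      ← intervalIntegral.integral_sub (hi2.const_mul _) (hi1.const_mul _)]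
    congr 1
    ext φ
    rw [Real.cos_add]
    ring
  have hcos : Real.cos α ≠ 1 := by
    intro h
    obtain ⟨n, hn⟩ := (Real.cos_eq_one_iff α).1 h
    apply hqp
    refine ⟨n, ?_⟩
    rw [hα, eq_div_iff hq'] at hn
    have : (p : ℝ) = q * n := by
      have := Real.pi_pos
      apply mul_left_cancel₀ (show (2 * Real.pi) ≠ 0 by positivity)
      linarith
    exact_mod_cast this
  have hsq := Real.sin_sq_add_cos_sq α
  have : (2 * (1 - Real.cos α)) * K = 0 := by
    linear_combination (1 - Real.cos α) * f1 + Real.sin α * f2 - K * hsq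
  rcases mul_eq_zero.1 this with h | h
  · exact absurd (by linarith) hcos
  · exact h

/-! ### Time of one turn on the unit circle. -/

/-- If the angular velocity on the unit circle is `G(z) / r`, one turn takes the time
`|r| ∫ du / G(e^{iu})`. -/
theorem two_pi_eq_abs_mul_integral_inv {z : ℝ → ℂ} {G : ℂ → ℝ} {r : ℝ} (hr : r ≠ 0)
    (hG : Continuous G) (hpos : ∀ w : ℂ, ‖w‖ = 1 → 0 < G w)
    (hz : ∀ θ, HasDerivAt z (((G (z θ) / r : ℝ) : ℂ) * Complex.I * z θ) θ)
    (hnorm : ∀ θ, ‖z θ‖ = 1) (hper : z (2 * Real.pi) = z 0)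
    (hinj : InjOn z (Ico 0 (2 * Real.pi))) :
    2 * Real.pi = |r| * ∫ u in (0 : ℝ)..(2 * Real.pi), (G (Complex.exp (u * Complex.I)))⁻¹ := by
  have hzc : Continuous z := continuous_iff_continuousAt.2 fun θ => (hz θ).continuousAt
  have hκc : Continuous fun θ => G (z θ) / r := (hG.comp hzc).div_const r
  -- A continuous lift of the argument of `z`.
  set s : ℝ → ℝ := fun θ => (z 0).arg + ∫ τ in (0 : ℝ)..θ, G (z τ) / r with hs
  have hs' : ∀ θ, HasDerivAt s (G (z θ) / r) θ := fun θ =>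
    (intervalIntegral.integral_hasDerivAt_right (hκc.intervalIntegrable _ _)
      hκc.aestronglyMeasurable.stronglyMeasurableAtFilter hκc.continuousAt).const_add _
  have hs0 : s 0 = (z 0).arg := by simp [hs]
  have hsc : Continuous s := continuous_iff_continuousAt.2 fun θ => (hs' θ).continuousAt
  have hexp : ∀ θ, z θ = Complex.exp (s θ * Complex.I) := by
    have hd : ∀ θ, HasDerivAt (fun θ => z θ * Complex.exp (-(s θ * Complex.I))) 0 θ := by
      intro θ
      have h1 := (((hs' θ).ofReal_comp.mul_const Complex.I).neg).cexp
      have h2 := (hz θ).mul h1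
      exact h2.congr_deriv (by simp only [Pi.neg_apply]; ring)
    have hconst := fun θ => is_const_of_deriv_eq_zero (fun θ => (hd θ).differentiableAt)
      (fun θ => (hd θ).deriv) θ 0
    have h0 : z 0 * Complex.exp (-(s 0 * Complex.I)) = 1 := by
      have := Complex.norm_mul_exp_arg_mul_I (z 0)
      rw [hnorm, Complex.ofReal_one, one_mul] at this
      rw [hs0]
      nth_rewrite 1 [← this]
      rw [← Complex.exp_add]
      simp
    intro θ
    have h1 := hconst θ
    rw [h0, Complex.exp_neg] at h1
    have h2 := Complex.exp_ne_zero (s θ * Complex.I)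
    field_simp at h1
    exact h1
  set g : ℝ → ℝ := fun u => (G (Complex.exp (u * Complex.I)))⁻¹ with hg
  have hgpos : ∀ u : ℝ, 0 < G (Complex.exp (u * Complex.I)) := fun u =>
    hpos _ (Complex.norm_exp_ofReal_mul_I u)
  have hgc : Continuous g := by
    refine Continuous.inv₀ (by fun_prop) fun u => (hgpos u).ne'
  have hgper : Function.Periodic g (2 * Real.pi) := by
    intro u
    simp only [hg]
    congr 2
    push_cast
    rw [add_mul, Complex.exp_add, Complex.exp_two_pi_mul_I, mul_one]
  have htime : ∫ u in s 0..s (2 * Real.pi), g u = 2 * Real.pi / r := by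
    have h1 := intervalIntegral.integral_comp_mul_deriv (a := 0) (b := 2 * Real.pi) (f := s)
      (f' := fun θ => G (z θ) / r) (g := g) (fun θ _ => hs' θ) hκc.continuousOn hgc
    rw [← h1]
    have : ∀ θ, (g ∘ s) θ * (G (z θ) / r) = 1 / r := by
      intro θ
      have := (hgpos (s θ)).ne'
      simp only [hg, Function.comp]
      rw [← hexp θ] at this ⊢
      field_simp
    simp only [this]
    simp
    ring
  obtain ⟨k, hk⟩ : ∃ k : ℤ, s (2 * Real.pi) = s 0 + k * (2 * Real.pi) := by
    rw [hexp, hexp 0, Complex.exp_eq_exp_iff_exists_int] at hper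
    obtain ⟨k, hk⟩ := hper
    refine ⟨k, ?_⟩
    have h1 := congrArg Complex.im hk
    simpa using h1
  have hpi := Real.pi_pos
  have hk0 : k ≠ 0 := by
    rintro rfl
    rw [hk, Int.cast_zero, zero_mul, add_zero, intervalIntegral.integral_same] at htime
    exact (div_ne_zero (by positivity) hr) htime.symm
  -- If the lift met another multiple of `2π` on its way, `z` would return to `z 0` too early,
  -- against injectivity. So the winding number `k` is `±1`.
  have hreach : ∀ σ : ℤ, σ ≠ 0 → σ ≠ k → s 0 + σ * (2 * Real.pi) ∉
      uIcc (s 0) (s (2 * Real.pi)) := by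
    intro σ hσ hσk hmem
    obtain ⟨θ, hθ, hθs⟩ := intermediate_value_uIcc (hsc.continuousOn (s := uIcc 0 (2 * Real.pi)))
      hmem
    rw [uIcc_of_le (by positivity)] at hθ
    have hne : θ ≠ 2 * Real.pi := by
      rintro rfl
      rw [hk] at hθs
      have : (k : ℝ) = σ := by
        apply mul_right_cancel₀ (show (2 * Real.pi) ≠ 0 by positivity)
        linarith
      exact hσk (by exact_mod_cast this.symm)
    have hzθ : z θ = z 0 := by
      rw [hexp, hexp 0, Complex.exp_eq_exp_iff_exists_int]
      refine ⟨σ, ?_⟩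
      rw [hθs]
      push_cast
      ring
    have := hinj ⟨hθ.1, lt_of_le_of_ne hθ.2 hne⟩ ⟨le_rfl, by positivity⟩ hzθ
    subst this
    have : (σ : ℝ) = 0 := by
      apply mul_right_cancel₀ (show (2 * Real.pi) ≠ 0 by positivity)
      linarith
    exact hσ (by exact_mod_cast this)
  have hk1 : k = 1 ∨ k = -1 := by
    rcases lt_or_gt_of_ne hk0 with h | h
    · right
      by_contra hne
      refine hreach (-1) (by norm_num) (Ne.symm hne) ?_
      have : (k : ℝ) ≤ -1 := by exact_mod_cast (by omega : k ≤ -1)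
      rw [mem_uIcc]
      right
      rw [hk]
      push_cast
      constructor <;> nlinarith
    · left
      by_contra hne
      refine hreach 1 (by norm_num) (Ne.symm hne) ?_
      have : (1 : ℝ) ≤ k := by exact_mod_cast (by omega : 1 ≤ k)
      rw [mem_uIcc]
      left
      rw [hk]
      push_cast
      constructor <;> nlinarith
  have hJ : 0 < ∫ u in (0 : ℝ)..(2 * Real.pi), g u :=
    intervalIntegral.intervalIntegral_pos_of_pos_on (hgc.intervalIntegrable _ _)
      (fun u _ => inv_pos.2 (hgpos u)) (by positivity)
  have habs : |2 * Real.pi / r| = ∫ u in (0 : ℝ)..(2 * Real.pi), g u := by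
    rw [← htime, hk]
    rcases hk1 with rfl | rfl
    · have := hgper.intervalIntegral_add_eq (s 0) 0
      rw [zero_add] at this
      rw [Int.cast_one, one_mul, this, abs_of_pos hJ]
    · have := hgper.intervalIntegral_add_eq (s 0 - 2 * Real.pi) 0
      rw [zero_add, sub_add_cancel] at this
      rw [intervalIntegral.integral_symm, abs_neg]
      push_cast
      rw [show s 0 + -1 * (2 * Real.pi) = s 0 - 2 * Real.pi by ring, this, abs_of_pos hJ]
  rw [← habs, abs_div, abs_of_pos (by positivity : 0 < 2 * Real.pi)]
  have := abs_pos.2 hr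
  field_simp

/-! ### The period integrals and their monotonicity. -/

namespace Cell

/-- The angular velocity of the unperturbed motion in the circular coordinate `w` on the level
`4 h = m ^ 2 - 1` of the cell. -/
noncomputable def circularSpeed : Cell → ℝ → ℂ → ℝ
  | right, m, w => Real.sqrt (2 * (1 + m * w.re))
  | left, m, w => Real.sqrt (2 * (1 + m * w.re))
  | outer, m, w => Real.sqrt (((1 + m) * w.im ^ 2 + (m - 1)) / 2)

/-- The period of the unperturbed motion on the level `4 h = m ^ 2 - 1` of the cell. -/
noncomputable def period (c : Cell) (m : ℝ) : ℝ :=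
  ∫ u in (0 : ℝ)..(2 * Real.pi), (c.circularSpeed m (Complex.exp (u * Complex.I)))⁻¹

/-- The values of `m = √(1 + 4 h)` on the cell. -/
def moduli : Cell → Set ℝ
  | right => Ioo 0 1
  | left => Ioo 0 1
  | outer => Ioi 1

theorem sqrt_mem_moduli {c : Cell} {h : ℝ} (hh : h ∈ c.energies) :
    Real.sqrt (1 + 4 * h) ∈ c.moduli := by
  cases c
  case outer =>
    have : 0 < h := hh
    change 1 < Real.sqrt (1 + 4 * h)
    rw [Real.lt_sqrt (by norm_num)]
    linarith
  all_goals
    obtain ⟨h1, h2⟩ : h ∈ Ioo (-(1 / 4) : ℝ) 0 := hh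
    refine ⟨Real.sqrt_pos.2 (by linarith), ?_⟩
    rw [Real.sqrt_lt' (by norm_num)]
    linarith

theorem continuous_circularSpeed (c : Cell) (m : ℝ) : Continuous (c.circularSpeed m) := by
  cases c
  case outer =>
    change Continuous fun w : ℂ => Real.sqrt (((1 + m) * w.im ^ 2 + (m - 1)) / 2)
    fun_prop
  all_goals
    change Continuous fun w : ℂ => Real.sqrt (2 * (1 + m * w.re))
    fun_prop

theorem circularSpeed_pos {c : Cell} {m : ℝ} (hm : m ∈ c.moduli) {w : ℂ} (hw : ‖w‖ = 1) :
    0 < c.circularSpeed m w := by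
  have hre : -1 ≤ w.re := by
    have := Complex.abs_re_le_norm w
    rw [hw] at this
    exact (abs_le.1 this).1
  cases c
  case outer =>
    have : 1 < m := hm
    refine Real.sqrt_pos.2 ?_
    have := mul_nonneg (show 0 ≤ 1 + m by linarith) (sq_nonneg w.im)
    linarith
  all_goals
    obtain ⟨h1, h2⟩ : m ∈ Ioo (0 : ℝ) 1 := hm
    refine Real.sqrt_pos.2 ?_
    nlinarith

/-- The speed increases with `m` at every point of the circle. -/
theorem period_outer_strictAntiOn : StrictAntiOn outer.period (Ioi 1) := by
  intro m hm n hn hmn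
  have hm1 : 1 < m := hm
  have hc : ∀ k ∈ outer.moduli, Continuous fun u : ℝ =>
      (outer.circularSpeed k (Complex.exp (u * Complex.I)))⁻¹ := fun k hk =>
    ((outer.continuous_circularSpeed k).comp (by fun_prop)).inv₀ fun u =>
      (circularSpeed_pos hk (Complex.norm_exp_ofReal_mul_I u)).ne'
  have hlt : ∀ u : ℝ, (outer.circularSpeed n (Complex.exp (u * Complex.I)))⁻¹ <
      (outer.circularSpeed m (Complex.exp (u * Complex.I)))⁻¹ := by
    intro u
    have hp := circularSpeed_pos (c := outer) hm (Complex.norm_exp_ofReal_mul_I u)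
    refine inv_strictAnti₀ hp (Real.sqrt_lt_sqrt ?_ ?_)
    · have := mul_nonneg (show 0 ≤ 1 + m by linarith)
        (sq_nonneg (Complex.exp (u * Complex.I)).im)
      linarith
    · have := mul_le_mul_of_nonneg_right hmn.le (sq_nonneg (Complex.exp (u * Complex.I)).im)
      linarith
  exact intervalIntegral.integral_lt_integral_of_continuousOn_of_le_of_exists_lt
    (by have := Real.pi_pos; positivity) (hc n hn).continuousOn (hc m hm).continuousOn
    (fun u _ => (hlt u).le) ⟨0, ⟨le_rfl, by have := Real.pi_pos; positivity⟩, hlt 0⟩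

/-- The inner integrand is not monotone in `m` pointwise, but its sum over antipodal points is a
function of `t ^ 2` alone, visibly increasing. -/
theorem inv_sqrt_add_inv_sqrt_eq {t : ℝ} (ht : t ^ 2 < 1) :
    (Real.sqrt (2 * (1 + t)))⁻¹ + (Real.sqrt (2 * (1 - t)))⁻¹ =
      Real.sqrt ((1 - t ^ 2)⁻¹ + (Real.sqrt (1 - t ^ 2))⁻¹) := by
  have h1 : -1 < t := by nlinarith
  have h2 : t < 1 := by nlinarith
  have hA : 0 < 1 + t := by linarith
  have hB : 0 < 1 - t := by linarith
  symm
  rw [Real.sqrt_eq_iff_mul_self_eq (by positivity) (by positivity),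
    show 1 - t ^ 2 = (1 + t) * (1 - t) by ring, Real.sqrt_mul hA.le,
    Real.sqrt_mul (by norm_num), Real.sqrt_mul (by norm_num)]
  have e1 := Real.sq_sqrt hA.le
  have e2 := Real.sq_sqrt hB.le
  have e3 := Real.sq_sqrt (show (0 : ℝ) ≤ 2 by norm_num)
  have e4 : Real.sqrt (1 + t) ^ 2 + Real.sqrt (1 - t) ^ 2 = 2 := by rw [e1, e2]; ring
  have p1 := Real.sqrt_pos.2 hA
  have p2 := Real.sqrt_pos.2 hB
  have p3 := Real.sqrt_pos.2 (show (0 : ℝ) < 2 by norm_num)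
  rw [← e1, ← e2]
  simp only [Real.sqrt_sq p1.le, Real.sqrt_sq p2.le]
  generalize Real.sqrt (1 + t) = a at *
  generalize Real.sqrt (1 - t) = b at *
  generalize Real.sqrt 2 = d at *
  field_simp
  rw [e3]
  linear_combination -e4

/-- Averaging the integrand over `u` and `u + π` gives the symmetric sum with `t = m cos u`, which
grows with `m ^ 2`. -/
theorem period_right_strictMonoOn : StrictMonoOn right.period (Ioo 0 1) := by
  have hc : ∀ k ∈ Ioo (0 : ℝ) 1, Continuous fun u : ℝ =>
      (Real.sqrt (2 * (1 + k * Real.cos u)))⁻¹ := by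
    intro k hk
    have := ((right.continuous_circularSpeed k).comp
      (show Continuous fun u : ℝ => Complex.exp (u * Complex.I) by fun_prop)).inv₀ fun u =>
      (circularSpeed_pos (c := right) hk (Complex.norm_exp_ofReal_mul_I u)).ne'
    refine this.congr fun u => ?_
    simp only [circularSpeed, Pi.inv_apply, Function.comp, Complex.exp_ofReal_mul_I_re]
  have hper : ∀ k, right.period k = ∫ u in (0 : ℝ)..(2 * Real.pi),
      (Real.sqrt (2 * (1 + k * Real.cos u)))⁻¹ := by
    intro k
    simp only [period, circularSpeed, Complex.exp_ofReal_mul_I_re]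
  have hsymm : ∀ k, right.period k = ∫ u in (0 : ℝ)..(2 * Real.pi),
      (Real.sqrt (2 * (1 - k * Real.cos u)))⁻¹ := by
    intro k
    have hp : Function.Periodic (fun u => (Real.sqrt (2 * (1 + k * Real.cos u)))⁻¹)
        (2 * Real.pi) := fun u => by simp only [Real.cos_add_two_pi]
    have h1 := hp.intervalIntegral_add_eq 0 Real.pi
    have h2 := intervalIntegral.integral_comp_add_right (a := 0) (b := 2 * Real.pi)
      (fun u => (Real.sqrt (2 * (1 + k * Real.cos u)))⁻¹) Real.pi
    rw [zero_add, add_comm _ Real.pi, ← h1, zero_add] at h2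
    rw [hper, ← h2]
    congr 1
    ext u
    rw [Real.cos_add_pi, mul_neg, ← sub_eq_add_neg]
  have hc' : ∀ k ∈ Ioo (0 : ℝ) 1, Continuous fun u : ℝ =>
      (Real.sqrt (2 * (1 - k * Real.cos u)))⁻¹ := by
    intro k hk
    have := (hc k hk).comp (continuous_id.add_const Real.pi)
    refine this.congr fun u => ?_
    simp only [Function.comp, id, Real.cos_add_pi, mul_neg, ← sub_eq_add_neg]
  have hdouble : ∀ k ∈ Ioo (0 : ℝ) 1, 2 * right.period k = ∫ u in (0 : ℝ)..(2 * Real.pi),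
      ((Real.sqrt (2 * (1 + k * Real.cos u)))⁻¹ + (Real.sqrt (2 * (1 - k * Real.cos u)))⁻¹) := by
    intro k hk
    rw [intervalIntegral.integral_add ((hc k hk).intervalIntegrable _ _)
      ((hc' k hk).intervalIntegrable _ _), ← hper, ← hsymm]
    ring
  intro m hm n hn hmn
  have hsq : m ^ 2 < n ^ 2 := by nlinarith [hm.1]
  have hn1 : n ^ 2 < 1 := by nlinarith [hn.1, hn.2]
  have hbd : ∀ k : ℝ, k ^ 2 < 1 → ∀ u : ℝ, (k * Real.cos u) ^ 2 < 1 := by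
    intro k hk u
    rw [mul_pow]
    nlinarith [Real.cos_sq_le_one u, sq_nonneg (Real.cos u), sq_nonneg k]
  have hmono : ∀ s t : ℝ, s < t → t < 1 → Real.sqrt ((1 - s)⁻¹ + (Real.sqrt (1 - s))⁻¹) <
      Real.sqrt ((1 - t)⁻¹ + (Real.sqrt (1 - t))⁻¹) := by
    intro s t hst ht
    have h1 : 0 < 1 - t := by linarith
    have h2 : 0 < 1 - s := by linarith
    refine Real.sqrt_lt_sqrt (by positivity) (add_lt_add ?_ ?_)
    · exact inv_strictAnti₀ h1 (by linarith)
    · exact inv_strictAnti₀ (Real.sqrt_pos.2 h1) (Real.sqrt_lt_sqrt h1.le (by linarith))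
  have key : 2 * right.period m < 2 * right.period n := by
    rw [hdouble m hm, hdouble n hn]
    refine intervalIntegral.integral_lt_integral_of_continuousOn_of_le_of_exists_lt
      (by have := Real.pi_pos; positivity) ((hc m hm).add (hc' m hm)).continuousOn
      ((hc n hn).add (hc' n hn)).continuousOn (fun u _ => ?_)
      -- The inequality degenerates where `cos u = 0`; strictness is taken at `u = 0`.
      ⟨0, ⟨le_rfl, by have := Real.pi_pos; positivity⟩, ?_⟩
    · rw [inv_sqrt_add_inv_sqrt_eq (hbd m (hsq.trans hn1) u),
        inv_sqrt_add_inv_sqrt_eq (hbd n hn1 u)]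
      have hle : (m * Real.cos u) ^ 2 ≤ (n * Real.cos u) ^ 2 := by
        rw [mul_pow, mul_pow]
        exact mul_le_mul_of_nonneg_right hsq.le (sq_nonneg _)
      rcases hle.lt_or_eq with h | h
      · exact (hmono _ _ h (hbd n hn1 u)).le
      · rw [h]
    · rw [inv_sqrt_add_inv_sqrt_eq (hbd m (hsq.trans hn1) 0),
        inv_sqrt_add_inv_sqrt_eq (hbd n hn1 0)]
      refine hmono _ _ ?_ (hbd n hn1 0)
      simpa using hsq
  linarith

theorem period_injOn (c : Cell) : InjOn c.period c.moduli := by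
  cases c
  case outer => exact period_outer_strictAntiOn.injOn
  all_goals exact period_right_strictMonoOn.injOn

end Cell

/-! ### From angle parametrizations to periods. -/

/-- `two_pi_eq_abs_mul_integral_inv` in terms of the cosine and the sine of the moving point. -/
theorem two_pi_eq_abs_mul_integral_inv_of_cos_sin {a b κ : ℝ → ℝ} {G : ℂ → ℝ} {r : ℝ}
    (hr : r ≠ 0) (hG : Continuous G) (hpos : ∀ w : ℂ, ‖w‖ = 1 → 0 < G w)
    (hκ : ∀ θ, κ θ = G ⟨a θ, b θ⟩ / r)
    (ha : ∀ θ, HasDerivAt a (-(κ θ * b θ)) θ) (hb : ∀ θ, HasDerivAt b (κ θ * a θ) θ)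
    (hnorm : ∀ θ, a θ ^ 2 + b θ ^ 2 = 1)
    (hpa : Function.Periodic a (2 * Real.pi)) (hpb : Function.Periodic b (2 * Real.pi))
    (hinj : ∀ s ∈ Ico 0 (2 * Real.pi), ∀ t ∈ Ico 0 (2 * Real.pi), a s = a t → b s = b t → s = t) :
    2 * Real.pi = |r| * ∫ u in (0 : ℝ)..(2 * Real.pi), (G (Complex.exp (u * Complex.I)))⁻¹ := by
  refine two_pi_eq_abs_mul_integral_inv (z := fun θ => ⟨a θ, b θ⟩) hr hG hpos ?_ ?_ ?_ ?_
  · intro θ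
    have h1 := (ha θ).ofReal_comp.add ((hb θ).ofReal_comp.mul_const Complex.I)
    have h2 : (fun θ => (⟨a θ, b θ⟩ : ℂ)) =
        (fun θ => ((a θ : ℝ) : ℂ)) + fun θ => ((b θ : ℝ) : ℂ) * Complex.I := by
      ext θ
      exact Complex.mk_eq_add_mul_I _ _
    rw [h2]
    refine h1.congr_deriv ?_
    rw [← hκ, Complex.mk_eq_add_mul_I]
    push_cast
    linear_combination -((κ θ : ℂ) * b θ) * Complex.I_sq
  · intro θ
    rw [Complex.norm_def, Complex.normSq_mk, ← sq, ← sq, hnorm, Real.sqrt_one]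
  · have h1 := hpa 0
    have h2 := hpb 0
    rw [zero_add] at h1 h2
    simp only [h1, h2]
  · intro s hs t ht hst
    exact hinj s hs t ht (congrArg Complex.re hst) (congrArg Complex.im hst)

namespace Cell

namespace IsAngleParametrization

variable {c : Cell} {h : ℝ} {x y : ℝ → ℝ}

/-- With `ω = 0`, division by zero makes both derivatives vanish, so the parametrization is constant
and not injective. -/
theorem frequency_ne_zero (H : c.IsAngleParametrization h x y) : c.frequency h ≠ 0 := by
  intro h0
  have hx : ∀ θ, HasDerivAt x 0 θ := fun θ => by simpa [h0] using H.hasDerivAt_x θ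
  have hy : ∀ θ, HasDerivAt y 0 θ := fun θ => by simpa [h0] using H.hasDerivAt_y θ
  have e1 := is_const_of_deriv_eq_zero (fun θ => (hx θ).differentiableAt)
    (fun θ => (hx θ).deriv) 0 1
  have e2 := is_const_of_deriv_eq_zero (fun θ => (hy θ).differentiableAt)
    (fun θ => (hy θ).deriv) 0 1
  have := Real.pi_gt_three
  have h01 := H.bijOn.injOn ⟨le_rfl, by linarith⟩ ⟨zero_le_one, by linarith⟩ (Prod.ext e1 e2)
  norm_num at h01

theorem mem_curve (H : c.IsAngleParametrization h x y) (θ : ℝ) : (x θ, y θ) ∈ c.curve h := by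
  have hp : Function.Periodic (fun θ => (x θ, y θ)) (2 * Real.pi) := fun θ =>
    Prod.ext (H.periodic_x θ) (H.periodic_y θ)
  obtain ⟨t, ht, e⟩ := hp.exists_mem_Ico₀ Real.two_pi_pos θ
  rw [e]
  exact H.bijOn.mapsTo ht

theorem sq_ordinate (H : c.IsAngleParametrization h x y) (hh : h ∈ c.energies) (θ : ℝ) :
    2 * y θ ^ 2 + (x θ ^ 2 - 1) ^ 2 = Real.sqrt (1 + 4 * h) ^ 2 := by
  have h1 : energy (x θ, y θ) = h := (H.mem_curve θ).1
  have h2 : 0 ≤ 1 + 4 * h := by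
    cases c
    case outer =>
      have : 0 < h := hh
      linarith
    all_goals
      have : -(1 / 4) < h := hh.1
      linarith
  rw [Real.sq_sqrt h2]
  simp only [energy] at h1
  linear_combination 4 * h1

/-- By `sq_ordinate` the point `((x² - 1) / m, √2 y / m)` lies on the unit circle, and it turns at
speed `√2 |x|`, where `x² = 1 + m Re w`. The sign `σ` of `x` treats both inner cells at once. -/
theorem two_pi_eq_of_inner (H : c.IsAngleParametrization h x y) (hh : h ∈ c.energies)
    {σ : ℝ} (hσ : σ ^ 2 = 1) (hx : ∀ θ, 0 < σ * x θ)
    (hc : c.circularSpeed = right.circularSpeed) (hm1 : c.moduli = Ioo 0 1) :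
    2 * Real.pi = |c.frequency h| * c.period (Real.sqrt (1 + 4 * h)) := by
  have hm := sqrt_mem_moduli hh
  have hsq := H.sq_ordinate hh
  set m := Real.sqrt (1 + 4 * h)
  have hm0 : 0 < m := by rw [hm1] at hm; exact hm.1
  have hω := H.frequency_ne_zero
  have hdx := H.hasDerivAt_x
  have hdy := H.hasDerivAt_y
  set ω := c.frequency h
  have hσ0 : σ ≠ 0 := by
    rintro rfl
    norm_num at hσ
  have hs2 : Real.sqrt 2 ^ 2 = 2 := Real.sq_sqrt (by norm_num)
  have hs2p : 0 < Real.sqrt 2 := Real.sqrt_pos.2 (by norm_num)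
  have hσ1 : |σ| = 1 := by rw [← Real.sqrt_sq_eq_abs, hσ, Real.sqrt_one]
  have habs : |-(σ * ω)| = |ω| := by rw [abs_neg, abs_mul, hσ1, one_mul]
  rw [← habs]
  refine two_pi_eq_abs_mul_integral_inv_of_cos_sin (a := fun θ => (x θ ^ 2 - 1) / m)
    (b := fun θ => Real.sqrt 2 * y θ / m) (κ := fun θ => -(Real.sqrt 2 * x θ / ω))
    -- The turning direction in this coordinate depends on the side; only `|r|` matters in the end.
    (neg_ne_zero.2 (mul_ne_zero hσ0 hω)) (c.continuous_circularSpeed m)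
    (fun w hw => circularSpeed_pos hm hw) ?_ ?_ ?_ ?_ ?_ ?_ ?_
  · intro θ
    have e : c.circularSpeed m ⟨(x θ ^ 2 - 1) / m, Real.sqrt 2 * y θ / m⟩ =
        Real.sqrt 2 * (σ * x θ) := by
      rw [hc]
      simp only [circularSpeed]
      rw [Real.sqrt_eq_iff_mul_self_eq_of_pos (mul_pos hs2p (hx θ))]
      field_simp
      rw [hs2, hσ]
      ring
    rw [e]
    field_simp
  · intro θ
    refine ((((hdx θ).pow 2).sub_const 1).div_const m).congr_deriv ?_
    push_cast
    field_simp
    linear_combination -(x θ * y θ) * hs2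
  · intro θ
    refine (((hdy θ).const_mul (Real.sqrt 2)).div_const m).congr_deriv ?_
    field_simp
    ring
  · intro θ
    have := hsq θ
    field_simp
    rw [hs2]
    linear_combination this
  · intro θ
    simp only [H.periodic_x θ]
  · intro θ
    simp only [H.periodic_y θ]
  -- The circle records only `x²`; the fixed sign of `x` recovers `x`.
  · intro s hs t ht h1 h2
    refine H.bijOn.injOn hs ht (Prod.ext ?_ ?_)
    · have h3 : x s ^ 2 = x t ^ 2 := by
        rw [div_left_inj' hm0.ne'] at h1
        linarith
      have h4 : (σ * x s) ^ 2 = (σ * x t) ^ 2 := by rw [mul_pow, mul_pow, h3]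
      have h5 := (sq_eq_sq₀ (hx s).le (hx t).le).1 h4
      exact mul_left_cancel₀ hσ0 h5
    · rw [div_left_inj' hm0.ne'] at h2
      exact mul_left_cancel₀ hs2p.ne' h2

/-- Here `2y² = (1 + m - x²)(x² + m - 1)` with a positive second factor, so `x = A sin u`, `y = A g
cos u` parametrizes the level, and `u` advances at speed `g`. -/
theorem two_pi_eq_of_outer (H : outer.IsAngleParametrization h x y) (hh : h ∈ outer.energies) :
    2 * Real.pi = |outer.frequency h| * outer.period (Real.sqrt (1 + 4 * h)) := by
  have hm := sqrt_mem_moduli hh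
  have hsq := H.sq_ordinate hh
  set m := Real.sqrt (1 + 4 * h)
  have hm1 : 1 < m := hm
  have hω := H.frequency_ne_zero
  have hdx := H.hasDerivAt_x
  have hdy := H.hasDerivAt_y
  set ω := outer.frequency h
  set A := Real.sqrt (1 + m) with hA
  have hA2 : A ^ 2 = 1 + m := Real.sq_sqrt (by linarith)
  have hA0 : 0 < A := Real.sqrt_pos.2 (by linarith)
  set g : ℝ → ℝ := fun θ => Real.sqrt ((x θ ^ 2 + (m - 1)) / 2) with hg
  have hpos : ∀ θ, 0 < (x θ ^ 2 + (m - 1)) / 2 := fun θ => by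
    have := sq_nonneg (x θ)
    linarith
  have hg2 : ∀ θ, g θ ^ 2 = (x θ ^ 2 + (m - 1)) / 2 := fun θ => Real.sq_sqrt (hpos θ).le
  have hg0 : ∀ θ, 0 < g θ := fun θ => Real.sqrt_pos.2 (hpos θ)
  have hg' : ∀ θ, HasDerivAt g (x θ * y θ / (2 * ω * g θ)) θ := by
    intro θ
    refine (((((hdx θ).pow 2).add_const (m - 1)).div_const 2).sqrt
      (hpos θ).ne').congr_deriv ?_
    have := (hg0 θ).ne'
    change _ / (2 * g θ) = _
    push_cast
    field_simp
  have hy2 : ∀ θ, y θ ^ 2 = (1 + m - x θ ^ 2) * g θ ^ 2 := by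
    intro θ
    rw [hg2]
    linear_combination (1 / 2) * hsq θ
  refine two_pi_eq_abs_mul_integral_inv_of_cos_sin (a := fun θ => y θ / (A * g θ))
    (b := fun θ => x θ / A) (κ := fun θ => g θ / ω) hω (outer.continuous_circularSpeed m)
    (fun w hw => circularSpeed_pos hm hw) ?_ ?_ ?_ ?_ ?_ ?_ ?_
  · intro θ
    simp only [circularSpeed, hg]
    rw [div_pow, hA2, mul_div_cancel₀ _ (by linarith : (1 + m) ≠ 0)]
  · intro θ
    have h1 := (hg0 θ).ne'
    refine ((hdy θ).div ((hg' θ).const_mul A) (by positivity)).congr_deriv ?_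
    have h2 := hy2 θ
    have h3 := hg2 θ
    change ((x θ - x θ ^ 3) / ω * (A * g θ) - y θ * (A * (x θ * y θ / (2 * ω * g θ)))) /
      (A * g θ) ^ 2 = _
    field_simp
    have h4 : g θ ^ 4 = ((x θ ^ 2 + (m - 1)) / 2) ^ 2 := by rw [← h3]; ring
    rw [h2, h3]
    linear_combination 2 * x θ * h4
  · intro θ
    have h1 := (hg0 θ).ne'
    refine ((hdx θ).div_const A).congr_deriv ?_
    field_simp
  · intro θ
    have h1 := (hg0 θ).ne'
    rw [div_pow, div_pow, mul_pow, hA2, hy2, mul_div_mul_right _ _ (by positivity)]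
    have : (1 + m) ≠ 0 := by linarith
    field_simp
    ring
  · intro θ
    simp only [hg, H.periodic_x θ, H.periodic_y θ]
  · intro θ
    simp only [H.periodic_x θ]
  · intro s hs t ht h1 h2
    rw [div_left_inj' hA0.ne'] at h2
    have h3 : g s = g t := by simp only [hg, h2]
    rw [h3, div_left_inj' (mul_pos hA0 (hg0 t)).ne'] at h1
    exact H.bijOn.injOn hs ht (Prod.ext h2 h1)

/-- The frequency on a level is `2π` over the period of the unperturbed motion. -/
theorem two_pi_eq (H : c.IsAngleParametrization h x y) (hh : h ∈ c.energies) :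
    2 * Real.pi = |c.frequency h| * c.period (Real.sqrt (1 + 4 * h)) := by
  cases c
  case right =>
    refine H.two_pi_eq_of_inner hh (σ := 1) (by norm_num) (fun θ => ?_) rfl rfl
    have : 0 < x θ := (H.mem_curve θ).2
    linarith
  case left =>
    refine H.two_pi_eq_of_inner hh (σ := -1) (by norm_num) (fun θ => ?_) (by rfl) rfl
    have : x θ < 0 := (H.mem_curve θ).2
    linarith
  case outer => exact H.two_pi_eq_of_outer hh

/-! ### Constancy of the averaged function. -/

/-- The averaged function is constant unless `q` divides `p`. -/
theorem deriv_averagedFunction_eq_zero (H : c.IsAngleParametrization h x y)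
    (p₁ p₂ p₃ : ℝ) {p q : ℤ} (hp : p ≠ 0) (hq : q ≠ 0) (hqp : ¬ q ∣ p) (v : ℝ) :
    deriv (averagedFunction p₁ p₂ p₃ p q x y) v = 0 := by
  have hxc : Continuous x := continuous_iff_continuousAt.2 fun θ => (H.hasDerivAt_x θ).continuousAt
  have hyc : Continuous y := continuous_iff_continuousAt.2 fun θ => (H.hasDerivAt_y θ).continuousAt
  set ω := c.frequency h
  have hQc : Continuous fun θ => y θ / ω := hyc.div_const ω
  have hPc : Continuous fun θ => (p₁ + p₂ * x θ - x θ ^ 2) * y θ * (y θ / ω) := by fun_prop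
  have hQ : Function.Periodic (fun θ => y θ / ω) (2 * Real.pi) := fun θ => by
    simp only [H.periodic_y θ]
  have hP : Function.Periodic (fun θ => (p₁ + p₂ * x θ - x θ ^ 2) * y θ * (y θ / ω))
      (2 * Real.pi) := fun θ => by
    simp only [H.periodic_y θ, H.periodic_x θ]
  have hform : ∀ w, averagedFunction p₁ p₂ p₃ p q x y w = 1 / (2 * Real.pi * (p : ℝ)) *
      ∫ φ in (0 : ℝ)..(2 * Real.pi * (p : ℝ)),
        (fun θ => (p₁ + p₂ * x θ - x θ ^ 2) * y θ * (y θ / ω)) (w + (q : ℝ) * φ / (p : ℝ)) := by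
    intro w
    have h0 := integral_sin_mul_comp_eq_zero hQc hQ hp hq hqp w
    have hc1 : Continuous fun φ : ℝ =>
        (fun θ => (p₁ + p₂ * x θ - x θ ^ 2) * y θ * (y θ / ω)) (w + (q : ℝ) * φ / (p : ℝ)) :=
      hPc.comp (by fun_prop)
    have hc2 : Continuous fun φ : ℝ => p₃ * (Real.sin φ *
        (fun θ => y θ / ω) (w + (q : ℝ) * φ / (p : ℝ))) :=
      continuous_const.mul (Real.continuous_sin.mul (hQc.comp (by fun_prop)))
    have h1 := intervalIntegral.integral_add (hc1.intervalIntegrable (μ := MeasureTheory.volume)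
      0 (2 * Real.pi * (p : ℝ))) (hc2.intervalIntegrable 0 (2 * Real.pi * (p : ℝ)))
    rw [intervalIntegral.integral_const_mul, h0, mul_zero, add_zero] at h1
    rw [averagedFunction, ← h1]
    congr 2
    ext φ
    rw [(H.hasDerivAt_x _).deriv, perturbation]
    ring
  have hconst : averagedFunction p₁ p₂ p₃ p q x y =
      fun _ => averagedFunction p₁ p₂ p₃ p q x y v := by
    ext w
    rw [hform, hform, integral_comp_add_mul_eq_of_periodic hP hp hq w v]
  rw [hconst, deriv_const]

end IsAngleParametrization

/-! ### Finiteness away from the saddle. -/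

/-- Levels of small energy enter every neighbourhood of the saddle. -/
theorem exists_mem_curve_of_abs_lt (c : Cell) {N : Set (ℝ × ℝ)} (hN : IsOpen N)
    (h0 : ((0 : ℝ), (0 : ℝ)) ∈ N) :
    ∃ δ > 0, ∀ h ∈ c.energies, |h| < δ → (c.curve h ∩ N).Nonempty := by
  have near : ∀ f : ℝ → ℝ × ℝ, Continuous f → f 0 = (0, 0) →
      ∃ δ > 0, ∀ h : ℝ, |h| < δ → f h ∈ N := by
    intro f hf hf0
    have h1 := (hN.preimage hf).mem_nhds (show (0 : ℝ) ∈ f ⁻¹' N by rw [mem_preimage, hf0]; exact h0)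
    obtain ⟨δ, hδ, hb⟩ := Metric.mem_nhds_iff.1 h1
    refine ⟨δ, hδ, fun h hh => hb ?_⟩
    rwa [Metric.mem_ball, Real.dist_eq, sub_zero]
  -- The turning point nearest the saddle; it tends to the origin as `h` tends to `0`.
  have inner : ∀ h ∈ Ioo (-(1 / 4) : ℝ) 0, ∀ σ : ℝ, σ ^ 2 = 1 →
      energy (σ * Real.sqrt (1 - Real.sqrt (1 + 4 * h)), 0) = h ∧
        0 < Real.sqrt (1 - Real.sqrt (1 + 4 * h)) := by
    intro h hh σ hσ
    have hm := sqrt_mem_moduli (c := right) hh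
    have h1 : 0 < 1 - Real.sqrt (1 + 4 * h) := sub_pos.2 hm.2
    have h2 := Real.sq_sqrt h1.le
    have h3 := Real.sq_sqrt (show 0 ≤ 1 + 4 * h by linarith [hh.1])
    refine ⟨?_, Real.sqrt_pos.2 h1⟩
    simp only [energy]
    rw [show ∀ s : ℝ, (σ * s) ^ 4 = (σ ^ 2) ^ 2 * (s ^ 2) ^ 2 from fun s => by ring, mul_pow, hσ, h2]
    linear_combination (1 / 4) * h3
  cases c
  case outer =>
    obtain ⟨δ, hδ, hb⟩ := near (fun h => (0, Real.sqrt (2 * h))) (by fun_prop) (by simp)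
    refine ⟨δ, hδ, fun h hh hlt => ⟨_, ⟨?_, mem_univ _⟩, hb h hlt⟩⟩
    have : 0 < h := hh
    simp only [energy]
    rw [Real.sq_sqrt (by linarith)]
    ring
  case right =>
    obtain ⟨δ, hδ, hb⟩ := near (fun h => (1 * Real.sqrt (1 - Real.sqrt (1 + 4 * h)), 0))
      (by fun_prop) (by simp)
    refine ⟨δ, hδ, fun h hh hlt => ⟨_, ⟨(inner h hh 1 (by norm_num)).1, ?_⟩, hb h hlt⟩⟩
    have := (inner h hh 1 (by norm_num)).2
    change 0 < 1 * Real.sqrt (1 - Real.sqrt (1 + 4 * h))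
    linarith
  case left =>
    obtain ⟨δ, hδ, hb⟩ := near (fun h => (-1 * Real.sqrt (1 - Real.sqrt (1 + 4 * h)), 0))
      (by fun_prop) (by simp)
    refine ⟨δ, hδ, fun h hh hlt => ⟨_, ⟨(inner h hh (-1) (by norm_num)).1, ?_⟩, hb h hlt⟩⟩
    have := (inner h hh 1 (by norm_num)).2
    change -1 * Real.sqrt (1 - Real.sqrt (1 + 4 * h)) < 0
    linarith

/-- The periods of the levels that stay away from the figure-eight are bounded. -/
theorem exists_period_le (c : Cell) {δ : ℝ} (hδ : 0 < δ) :
    ∃ T, ∀ h ∈ c.energies, δ ≤ |h| → c.period (Real.sqrt (1 + 4 * h)) ≤ T := by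
  have inner : ∃ T, ∀ h ∈ Ioo (-(1 / 4) : ℝ) 0, δ ≤ |h| →
      right.period (Real.sqrt (1 + 4 * h)) ≤ T := by
    -- The cap `1 / 8` keeps `-ε` an energy of the cell when `δ` is large.
    set ε := min δ (1 / 8)
    have hε : -ε ∈ Ioo (-(1 / 4) : ℝ) 0 :=
      ⟨by have := min_le_right δ (1 / 8); linarith,
        neg_neg_of_pos (lt_min hδ (by norm_num))⟩
    refine ⟨right.period (Real.sqrt (1 + 4 * -ε)), fun h hh hle => ?_⟩
    refine period_right_strictMonoOn.monotoneOn (sqrt_mem_moduli (c := right) hh)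
      (sqrt_mem_moduli (c := right) hε) (Real.sqrt_le_sqrt ?_)
    rw [abs_of_neg hh.2] at hle
    have := min_le_left δ (1 / 8)
    linarith
  cases c
  case outer =>
    have hδ' : δ ∈ outer.energies := hδ
    refine ⟨outer.period (Real.sqrt (1 + 4 * δ)), fun h hh hle => ?_⟩
    have hh' : 0 < h := hh
    rw [abs_of_pos hh'] at hle
    exact period_outer_strictAntiOn.antitoneOn (sqrt_mem_moduli hδ') (sqrt_mem_moduli hh)
      (Real.sqrt_le_sqrt (by linarith))
  all_goals exact inner

/-- Only finitely many levels with periods commensurable to `τ` stay outside a neighbourhood of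
the saddle. -/
theorem finite_setOf_curve_period_eq (c : Cell) {N : Set (ℝ × ℝ)} (hN : IsOpen N)
    (h0 : ((0 : ℝ), (0 : ℝ)) ∈ N) {τ : ℝ} (hτ : 0 < τ) :
    {γ : Set (ℝ × ℝ) | Disjoint γ N ∧ ∃ h ∈ c.energies, γ = c.curve h ∧
      ∃ n : ℕ, c.period (Real.sqrt (1 + 4 * h)) = n * τ}.Finite := by
  obtain ⟨δ, hδ, hmeet⟩ := c.exists_mem_curve_of_abs_lt hN h0
  obtain ⟨T, hT⟩ := c.exists_period_le hδ
  have hsub : ∀ n : ℕ, {γ : Set (ℝ × ℝ) | ∃ h ∈ c.energies, γ = c.curve h ∧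
      c.period (Real.sqrt (1 + 4 * h)) = n * τ}.Subsingleton := by
    rintro n _ ⟨h, hh, rfl, e⟩ _ ⟨k, hk, rfl, e'⟩
    have h1 := c.period_injOn (sqrt_mem_moduli hh) (sqrt_mem_moduli hk) (e.trans e'.symm)
    have nonneg : ∀ l ∈ c.energies, 0 ≤ 1 + 4 * l := by
      intro l hl
      cases c
      case outer =>
        have : 0 < l := hl
        linarith
      all_goals
        have : -(1 / 4) < l := hl.1
        linarith
    have h2 := (Real.sqrt_inj (nonneg h hh) (nonneg k hk)).1 h1
    rw [show h = k by linarith]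
  -- At most one curve for each multiple `n * τ ≤ T`.
  refine ((finite_Iic ⌊T / τ⌋₊).biUnion fun n _ => (hsub n).finite).subset ?_
  rintro γ ⟨hd, h, hh, rfl, n, e⟩
  have hle : δ ≤ |h| := by
    by_contra hlt
    obtain ⟨z, hz, hzN⟩ := hmeet h hh (not_le.1 hlt)
    exact disjoint_left.1 hd hz hzN
  refine mem_biUnion (x := n) ?_ ⟨h, hh, rfl, e⟩
  refine Nat.le_floor ?_
  rw [le_div_iff₀ hτ, ← e]
  exact hT h hh hle

end Cell

/-! ### Splittable levels and the conclusion. -/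

theorem IsSplittableResonanceLevel.exists_period_eq {p₁ p₂ p₃ p₄ : ℝ} {γ : Set (ℝ × ℝ)}
    (hγ : IsSplittableResonanceLevel p₁ p₂ p₃ p₄ γ) :
    p₄ ≠ 0 ∧ ∃ c : Cell, ∃ h ∈ c.energies, γ = c.curve h ∧
      ∃ n : ℕ, c.period (Real.sqrt (1 + 4 * h)) = n * (2 * Real.pi / |p₄|) := by
  obtain ⟨c, h, hh, rfl, p, q, hp, hpq, hω, x, y, H, v, -, hv⟩ := hγ
  have hω0 := H.frequency_ne_zero
  have hq : q ≠ 0 := by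
    rintro rfl
    simp [hω] at hω0
  have hp₄ : p₄ ≠ 0 := by
    rintro rfl
    simp [hω] at hω0
  have hdvd : q ∣ p := by
    by_contra hn
    exact hv (H.deriv_averagedFunction_eq_zero p₁ p₂ p₃ hp hq hn v)
  -- A common divisor of coprime integers is a unit, and `q` divides both.
  have hu : |q| = 1 := Int.isUnit_iff_abs_eq.1 (hpq.isUnit_of_dvd' hdvd dvd_rfl)
  refine ⟨hp₄, c, h, hh, rfl, p.natAbs, ?_⟩
  have key := H.two_pi_eq hh
  have hp' : (0 : ℝ) < |(p : ℝ)| := abs_pos.2 (by exact_mod_cast hp)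
  have hp₄' := abs_pos.2 hp₄
  have hq' : |(q : ℝ)| = 1 := by exact_mod_cast hu
  rw [hω, abs_mul, abs_div, hq'] at key
  rw [Nat.cast_natAbs, Int.cast_abs, key]
  field_simp

theorem theorem3 (p₁ p₂ p₃ p₄ : ℝ) (N W : Set (ℝ × ℝ))
    (hN : IsOpen N) (hN_eight : figureEight ⊆ N)
    (hW : IsOpen W)
    (hW_zero : ∀ c : Cell, ∀ h ∈ c.energies,
      Cell.generatingFunction p₁ p₂ c h = 0 → c.curve h ⊆ W) :
    {γ : Set (ℝ × ℝ) | IsSplittableResonanceLevel p₁ p₂ p₃ p₄ γ ∧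
      γ ⊆ remainingRegion N W}.Finite := by
  by_cases hp₄ : p₄ = 0
  · refine finite_empty.subset ?_
    rintro γ ⟨hγ, -⟩
    exact hγ.exists_period_eq.1 hp₄
  have h0 : ((0 : ℝ), (0 : ℝ)) ∈ N := hN_eight (by simp [figureEight, energy])
  have hτ : 0 < 2 * Real.pi / |p₄| := div_pos Real.two_pi_pos (abs_pos.2 hp₄)
  have hfin := fun c : Cell => c.finite_setOf_curve_period_eq hN h0 hτ
  refine ((hfin .right).union ((hfin .left).union (hfin .outer))).subset ?_
  rintro γ ⟨hγ, hsub⟩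
  have hd : Disjoint γ N := disjoint_left.2 fun z hz hzN => (hsub hz).2 (Or.inl hzN)
  obtain ⟨-, c, hc⟩ := hγ.exists_period_eq
  cases c
  exacts [Or.inl ⟨hd, hc⟩, Or.inr (Or.inl ⟨hd, hc⟩), Or.inr (Or.inr ⟨hd, hc⟩)]
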